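/- For positive integers $d,k$ and a finite set $A\subset\mathbb{Z}^d$ let $kA=\{a_1+\dots+a_k : a_1,\dots,a_k\in A\}$ denote the $k$-fold sumset of $A$, and put $$ m_d(k):=\inf\left\{\frac{|kA|}{|A|} \;:\; A\subset\mathbb{Z}^d \text{ finite},\ \{0,1,\dots,k-1\}^d\subseteq A\right\}. $$ Then for all integers $d\ge 1$ and $k\ge 1$, $$ k^{\frac{d(k-1)}{k}}\;\le\; m_d(k)\;\le\;\left(k-1+\frac1k\right)^d . $$ Moreover, for every fixed $d\ge 1$ these bounds are asymptotically sharp as $k\to\infty$: $$ \lim_{k\to\infty}\frac{\left(k-1+\frac1k\right)^d}{k^{\frac{d(k-1)}{k}}}=1, $$ and hence $$ \lim_{k\to\infty}\frac{m_d(k)}{k^{\frac{d(k-1)}{k}}}=\lim_{k\to\infty}\frac{m_d(k)}{\left(k-1+\frac1k\right)^d}=1 . $$ -/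

import Mathlib

open Filter Topology

namespace CubeSumset

/-- The discrete cube `{0, 1, …, k - 1}^d` in `ℤ^d`. -/
noncomputable def cube (d k : ℕ) : Finset (Fin d → ℤ) :=
  Fintype.piFinset fun _ => Finset.Ico (0 : ℤ) (k : ℤ)

/-- The `k`-fold sumset `kA = A + A + ⋯ + A` (`k` summands): all sums `a₁ + ⋯ + aₖ` with every
`aᵢ ∈ A`, repetitions allowed. -/
def kSumset {d : ℕ} (k : ℕ) (A : Finset (Fin d → ℤ)) : Finset (Fin d → ℤ) :=
  (Fintype.piFinset fun _ : Fin k => A).image fun a => ∑ i, a i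

/-- The set of all ratios `|kA| / |A|`, where `A` runs over the finite subsets of `ℤ^d`
that contain the cube `{0, 1, …, k - 1}^d`. -/
def growthRatios (d k : ℕ) : Set ℝ :=
  {r | ∃ A : Finset (Fin d → ℤ), cube d k ⊆ A ∧ r = ((kSumset k A).card : ℝ) / (A.card : ℝ)}

/-- The infimum of `|kA| / |A|` over all finite `A ⊆ ℤ^d` with `{0, 1, …, k - 1}^d ⊆ A`. -/
noncomputable def infGrowth (d k : ℕ) : ℝ := sInf (growthRatios d k)

/-- `infGrowth` is a genuine infimum: the set of ratios is nonempty and bounded below. -/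
theorem isGLB_infGrowth (d k : ℕ) : IsGLB (growthRatios d k) (infGrowth d k) := by
  refine isGLB_csInf ⟨_, cube d k, Finset.Subset.refl _, rfl⟩ ⟨0, ?_⟩
  rintro r ⟨A, -, rfl⟩
  positivity

end CubeSumset

/-!
The lower bound rests on compression. Replacing every fibre of `A` in a coordinate direction by the
initial segment of `ℕ` of the same size preserves `|A|`, does not increase `|kA|` (Cauchy–Davenport
on fibres) and keeps the cube inside `A`, so `A` may be taken to be a down-set. For a down-set,
`kA` contains every box `[0, k x]` with `x ∈ A` and, thanks to the cube, also every box
`[0, (k - 1) (x + 1)]`. Cutting these two families of boxes into disjoint blocks indexed by `x ∈ A`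
bounds `|kA|` below by two sums over `A` of products over the coordinates, and a weighted AM–GM
inequality turns the two bounds into `k ^ (d (k - 1) / k) * |A|`. The upper bound is the ratio for
the cube itself, and the quotient of the two bounds is
`((1 - 1 / k + 1 / k ^ 2) * k ^ (1 / k)) ^ d`, which tends to `1`.
-/

namespace CubeSumset

open Finset
open scoped Pointwise

section Sumset

theorem kSumset_eq_nsmul {d : ℕ} (k : ℕ) (A : Finset (Fin d → ℤ)) : kSumset k A = k • A := by
  refine Finset.coe_injective ?_
  rw [kSumset, coe_image, Fintype.coe_piFinset, Set.image_fintype_sum_pi]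
  simp

theorem cube_succ (d k : ℕ) : cube d (k + 1) = Icc 0 (k : Fin d → ℤ) := by
  ext x
  simp [cube, Pi.le_def, forall_and]

variable {α : Type*} [AddCommGroup α] [Lattice α] [IsOrderedAddMonoid α] [LocallyFiniteOrder α]
  [DecidableEq α] {a b c d : α}

theorem Icc_add_Icc_of_le (hab : a ≤ b) (hcd : c ≤ d) :
    Icc a b + Icc c d = Icc (a + c) (b + d) := by
  refine (Finset.Icc_add_Icc_subset a b c d).antisymm fun x hx => ?_
  rw [mem_Icc] at hx
  refine mem_add.2 ⟨(x - c) ⊓ b, mem_Icc.2 ⟨le_inf (le_sub_iff_add_le.2 hx.1) hab, inf_le_right⟩,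
    x - (x - c) ⊓ b, mem_Icc.2 ?_, add_sub_cancel _ _⟩
  rw [sub_inf, sub_sub_cancel]
  exact ⟨le_sup_left, sup_le hcd (sub_le_iff_le_add'.2 hx.2)⟩

theorem nsmul_Icc_of_le (hab : a ≤ b) (n : ℕ) : n • Icc a b = Icc (n • a) (n • b) := by
  induction n with
  | zero => simp only [zero_nsmul, Icc_self, singleton_zero]
  | succ n ih =>
    rw [succ_nsmul, ih, Icc_add_Icc_of_le (nsmul_le_nsmul_right hab n) hab, ← succ_nsmul,
      ← succ_nsmul]

end Sumset

section DownSet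

variable {ι : Type*} {A : Finset (ι → ℤ)} {x : ι → ℤ}

/-- `A` is a down-set in the directions of the coordinates in `s`: on these its points have
non-negative entries, which may be decreased arbitrarily within the non-negative integers. -/
def IsCompressed (s : Set ι) (A : Finset (ι → ℤ)) : Prop :=
  ∀ x ∈ A, (∀ i ∈ s, 0 ≤ x i) ∧
    ∀ y : ι → ℤ, (∀ i ∈ s, 0 ≤ y i ∧ y i ≤ x i) → (∀ i ∉ s, y i = x i) → y ∈ A

theorem IsCompressed.nonneg (h : IsCompressed Set.univ A) (hx : x ∈ A) : 0 ≤ x :=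
  fun i => (h x hx).1 i trivial

theorem IsCompressed.Icc_zero_subset [Fintype ι] [DecidableEq ι] (h : IsCompressed Set.univ A)
    (hx : x ∈ A) : Icc 0 x ⊆ A := fun y hy =>
  (h x hx).2 y (fun i _ => ⟨(mem_Icc.1 hy).1 i, (mem_Icc.1 hy).2 i⟩) fun _ hi => absurd trivial hi

end DownSet

section Compression

variable {ι : Type*} [DecidableEq ι] {A : Finset (ι → ℤ)} {i : ι} {x : ι → ℤ} {t : ℤ}

/-- The fibre of `A` through `x` in the direction of the `i`-th coordinate, as a set of values of
that coordinate. It does not depend on `x i`. -/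
noncomputable def fiber (A : Finset (ι → ℤ)) (i : ι) (x : ι → ℤ) : Finset ℤ :=
  A.preimage (Function.update x i) (Function.update_injective x i).injOn

theorem mem_fiber : t ∈ fiber A i x ↔ Function.update x i t ∈ A := mem_preimage

@[simp]
theorem fiber_update (A : Finset (ι → ℤ)) (i : ι) (x : ι → ℤ) (t : ℤ) :
    fiber A i (Function.update x i t) = fiber A i x := by
  ext s
  simp only [mem_fiber, Function.update_idem]

variable [Fintype ι]

theorem card_eq_sum_card_fiber (A : Finset (ι → ℤ)) (i : ι) :
    #A = ∑ x ∈ A.image (Function.update · i 0), #(fiber A i x) := by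
  rw [card_eq_sum_card_image (Function.update · i 0)]
  refine sum_congr rfl (forall_mem_image.2 fun x _ => ?_)
  rw [fiber_update, ← card_image_of_injective (fiber A i x) (Function.update_injective x i)]
  congr 1
  ext y
  simp only [mem_filter, mem_image, mem_fiber]
  constructor
  · rintro ⟨hy, hyx⟩
    have hxy : Function.update x i (y i) = y := by
      rw [← Function.update_idem (a := i) (0 : ℤ), ← hyx, Function.update_idem,
        Function.update_eq_self]
    exact ⟨y i, hxy.symm ▸ hy, hxy⟩
  · rintro ⟨t, ht, rfl⟩
    exact ⟨ht, Function.update_idem ..⟩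

/-- The compression of `A` along the `i`-th coordinate: every fibre in this direction is replaced
by the initial segment of `ℕ` of the same cardinality. -/
noncomputable def compress (i : ι) (A : Finset (ι → ℤ)) : Finset (ι → ℤ) :=
  A.biUnion fun x => (Ico (0 : ℤ) #(fiber A i x)).image (Function.update x i)

theorem mem_compress : x ∈ compress i A ↔ 0 ≤ x i ∧ x i < #(fiber A i x) := by
  simp only [compress, mem_biUnion, mem_image, mem_Ico]
  constructor
  · rintro ⟨y, -, t, ht, rfl⟩
    simpa using ht
  · intro hx
    obtain ⟨t, ht⟩ : (fiber A i x).Nonempty := card_pos.1 (by omega)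
    exact ⟨_, mem_fiber.1 ht, x i, by simpa using hx, by simp⟩

theorem fiber_nonempty_of_mem_compress (hx : x ∈ compress i A) : (fiber A i x).Nonempty := by
  rw [mem_compress] at hx
  exact card_pos.1 (by omega)

theorem fiber_compress (i : ι) (A : Finset (ι → ℤ)) (x : ι → ℤ) :
    fiber (compress i A) i x = Ico (0 : ℤ) #(fiber A i x) := by
  ext t
  simp [mem_fiber, mem_compress]

theorem card_compress (i : ι) (A : Finset (ι → ℤ)) : #(compress i A) = #A := by
  have base : (compress i A).image (Function.update · i 0) = A.image (Function.update · i 0) := by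
    ext z
    simp only [mem_image]
    constructor
    · rintro ⟨x, hx, rfl⟩
      obtain ⟨t, ht⟩ := fiber_nonempty_of_mem_compress hx
      exact ⟨_, mem_fiber.1 ht, Function.update_idem ..⟩
    · rintro ⟨x, hx, rfl⟩
      have hpos : 0 < #(fiber A i x) := card_pos.2 ⟨x i, mem_fiber.2 (by simpa using hx)⟩
      exact ⟨Function.update x i 0, mem_compress.2 (by simpa using hpos), Function.update_idem ..⟩
  rw [card_eq_sum_card_fiber _ i, card_eq_sum_card_fiber A i, base]
  simp [fiber_compress]

theorem compress_add_compress_subset (i : ι) (A B : Finset (ι → ℤ)) :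
    compress i A + compress i B ⊆ compress i (A + B) := by
  refine add_subset_iff.2 fun x hx y hy => ?_
  have hadd : fiber A i x + fiber B i y ⊆ fiber (A + B) i (x + y) := by
    refine add_subset_iff.2 fun s hs t ht => ?_
    rw [mem_fiber, Function.update_add]
    exact add_mem_add (mem_fiber.1 hs) (mem_fiber.1 ht)
  have hcard : #(fiber A i x) + #(fiber B i y) - 1 ≤ #(fiber (A + B) i (x + y)) :=
    (cauchy_davenport_of_isAddTorsionFree (fiber_nonempty_of_mem_compress hx)
      (fiber_nonempty_of_mem_compress hy)).trans (card_le_card hadd)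
  rw [mem_compress] at *
  simp only [Pi.add_apply]
  omega

theorem nsmul_compress_subset (i : ι) (A : Finset (ι → ℤ)) (n : ℕ) :
    n • compress i A ⊆ compress i (n • A) := by
  induction n with
  | zero =>
    have h0 : (0 : ℤ) ∈ fiber (0 : Finset (ι → ℤ)) i 0 := mem_fiber.2 (by simp)
    simpa [mem_compress] using ⟨_, h0⟩
  | succ n ih =>
    rw [succ_nsmul, succ_nsmul]
    exact (add_subset_add_right ih).trans (compress_add_compress_subset i _ _)

theorem card_nsmul_compress_le (i : ι) (A : Finset (ι → ℤ)) (n : ℕ) :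
    #(n • compress i A) ≤ #(n • A) :=
  (card_le_card (nsmul_compress_subset i A n)).trans (card_compress i _).le

theorem Icc_zero_subset_compress {c : ι → ℤ} (h : Icc 0 c ⊆ A) (i : ι) :
    Icc 0 c ⊆ compress i A := by
  intro x hx
  rw [mem_Icc] at hx
  have hfiber : Icc 0 (c i) ⊆ fiber A i x := fun t ht => by
    rw [mem_Icc] at ht
    exact mem_fiber.2 (h (mem_Icc.2 ⟨le_update_iff.2 ⟨ht.1, fun j _ => hx.1 j⟩,
      update_le_iff.2 ⟨ht.2, fun j _ => hx.2 j⟩⟩))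
  have hcard := card_le_card hfiber
  have h0 : 0 ≤ x i := hx.1 i
  have hc : x i ≤ c i := hx.2 i
  rw [Int.card_Icc] at hcard
  rw [mem_compress]
  omega

theorem IsCompressed.compress {s : Set ι} (h : IsCompressed s A) (j : ι) :
    IsCompressed (insert j s) (compress j A) := by
  intro x hx
  obtain ⟨t, ht⟩ := fiber_nonempty_of_mem_compress hx
  rw [mem_compress] at hx
  refine ⟨fun i hi => ?_, fun y hys hyn => mem_compress.2 ?_⟩
  · rcases eq_or_ne i j with rfl | hij
    · exact hx.1
    · simpa [hij] using (h _ (mem_fiber.1 ht)).1 i (hi.resolve_left hij)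
  · have hfiber : fiber A j x ⊆ fiber A j y := fun t ht => by
      rw [mem_fiber] at ht ⊢
      refine (h _ ht).2 _ (fun i hi => ?_) fun i hi => ?_
      · rcases eq_or_ne i j with rfl | hij
        · simpa using (h _ ht).1 i hi
        · simpa [hij] using hys i (.inr hi)
      · rcases eq_or_ne i j with rfl | hij
        · simp
        · simpa [hij] using hyn i (by simp [hij, hi])
    have hy := hys j (.inl rfl)
    have hcard := card_le_card hfiber
    omega

theorem exists_isCompressed_univ (A : Finset (ι → ℤ)) :
    ∃ B : Finset (ι → ℤ), IsCompressed Set.univ B ∧ #B = #A ∧ (∀ n : ℕ, #(n • B) ≤ #(n • A)) ∧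
      ∀ c, Icc 0 c ⊆ A → Icc 0 c ⊆ B := by
  suffices H : ∀ s : Finset ι, ∃ B : Finset (ι → ℤ), IsCompressed s B ∧ #B = #A ∧
      (∀ n : ℕ, #(n • B) ≤ #(n • A)) ∧ ∀ c, Icc 0 c ⊆ A → Icc 0 c ⊆ B by
    simpa only [coe_univ] using H univ
  intro s
  induction s using Finset.induction_on with
  | empty =>
    have hA : IsCompressed (∅ : Finset ι) A := fun x hx =>
      ⟨by simp, fun y _ hy => (funext fun i => hy i (by simp) : y = x) ▸ hx⟩
    exact ⟨A, hA, rfl, fun _ => le_rfl, fun _ => id⟩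
  | insert j s _ ih =>
    obtain ⟨B, hB, hcard, hsum, hbox⟩ := ih
    refine ⟨compress j B, ?_, (card_compress j B).trans hcard,
      fun n => (card_nsmul_compress_le j B n).trans (hsum n),
      fun c hc => Icc_zero_subset_compress (hbox c hc) j⟩
    rw [coe_insert]
    exact hB.compress j

end Compression

section BlockCounting

variable {ι : Type*} [Fintype ι] [DecidableEq ι] {A S : Finset (ι → ℤ)}

theorem sum_prod_card_Ioc_le_card {b : ℤ → ℤ} (hb : Monotone b)
    (h : ∀ x ∈ A, Fintype.piFinset (fun i => Ioc (b (x i)) (b (x i + 1))) ⊆ S) :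
    ∑ x ∈ A, ∏ i, #(Ioc (b (x i)) (b (x i + 1))) ≤ #S := by
  have hdisj : (A : Set (ι → ℤ)).PairwiseDisjoint
      fun x => Fintype.piFinset fun i => Ioc (b (x i)) (b (x i + 1)) := by
    intro x _ x' _ hne
    obtain ⟨i, hi⟩ := Function.ne_iff.1 hne
    have hdisj_i : Disjoint (Set.Ioc (b (x i)) (b (x i + 1)))
        (Set.Ioc (b (x' i)) (b (x' i + 1))) := hb.pairwise_disjoint_on_Ioc_succ hi
    refine Finset.disjoint_left.2 fun y hy hy' => Set.disjoint_left.1 hdisj_i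
      (mem_Ioc.1 (Fintype.mem_piFinset.1 hy i)) (mem_Ioc.1 (Fintype.mem_piFinset.1 hy' i))
  calc ∑ x ∈ A, ∏ i, #(Ioc (b (x i)) (b (x i + 1)))
      = #(A.biUnion fun x => Fintype.piFinset fun i => Ioc (b (x i)) (b (x i + 1))) := by
        simp only [card_biUnion hdisj, Fintype.card_piFinset]
    _ ≤ #S := card_le_card (biUnion_subset.2 h)

/-- The left endpoints of the half-open blocks `Ioc (blockStart c m t) (blockStart c m (t + 1))`
that cut `ℕ` into `{0, …, c}` for `t = 0` and consecutive intervals of length `m` for `t ≥ 1`. The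
blocks with `t < 0` are empty. -/
def blockStart (c m : ℕ) (t : ℤ) : ℤ :=
  if t ≤ 0 then -1 else c + m * (t - 1)

theorem monotone_blockStart (c m : ℕ) : Monotone (blockStart c m) := by
  intro s t hst
  unfold blockStart
  have hmul : (m : ℤ) * (s - 1) ≤ m * (t - 1) := by gcongr
  have hnonneg : 0 < t → 0 ≤ (m : ℤ) * (t - 1) := fun ht => mul_nonneg (by positivity) (by omega)
  split_ifs <;> omega

theorem neg_one_le_blockStart (c m : ℕ) (t : ℤ) : -1 ≤ blockStart c m t :=
  calc -1 = blockStart c m (min t 0) := by simp [blockStart]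
    _ ≤ blockStart c m t := monotone_blockStart c m (min_le_left t 0)

theorem blockStart_add_one {t : ℤ} (ht : 0 ≤ t) (c m : ℕ) : blockStart c m (t + 1) = c + m * t := by
  rw [blockStart, if_neg (by omega), add_sub_cancel_right]

theorem card_Ioc_blockStart {t : ℤ} (ht : 0 ≤ t) (c m : ℕ) :
    #(Ioc (blockStart c m t) (blockStart c m (t + 1))) = if t = 0 then c + 1 else m := by
  rw [Int.card_Ioc, blockStart_add_one ht, blockStart]
  split_ifs with hle heq heq
  · simp only [heq, mul_zero]
    omega
  · omega
  · omega
  · rw [show (c : ℤ) + m * t - (c + m * (t - 1)) = m by ring, Int.toNat_natCast]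

theorem sum_prod_ite_le_card {c m : ℕ} (hA : ∀ x ∈ A, 0 ≤ x)
    (hS : ∀ x ∈ A, Icc 0 ((c : ι → ℤ) + m • x) ⊆ S) :
    ∑ x ∈ A, ∏ i, (if x i = 0 then c + 1 else m) ≤ #S := by
  calc ∑ x ∈ A, ∏ i, (if x i = 0 then c + 1 else m)
      = ∑ x ∈ A, ∏ i, #(Ioc (blockStart c m (x i)) (blockStart c m (x i + 1))) :=
        sum_congr rfl fun x hx => prod_congr rfl fun i _ =>
          (card_Ioc_blockStart (hA x hx i) c m).symm
    _ ≤ #S := sum_prod_card_Ioc_le_card (monotone_blockStart c m) fun x hx y hy => hS x hx ?_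
  have hy' := fun i => mem_Ioc.1 (Fintype.mem_piFinset.1 hy i)
  refine mem_Icc.2 ⟨fun i => ?_, fun i => ?_⟩
  · exact (neg_one_le_blockStart c m (x i)).trans_lt (hy' i).1
  · simpa [blockStart_add_one (hA x hx i)] using (hy' i).2

end BlockCounting

section LowerBound

theorem add_one_pow_le_add_one_mul_pow {m n : ℕ} (h : n ≤ m) : (m + 1) ^ n ≤ (n + 1) * m ^ n := by
  induction n with
  | zero => simp
  | succ n ih =>
    calc (m + 1) ^ (n + 1) = (m + 1) ^ n * (m + 1) := pow_succ _ _
      _ ≤ (n + 1) * m ^ n * (m + 1) := Nat.mul_le_mul_right _ (ih (by omega))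
      _ = (n + 1) * (m + 1) * m ^ n := by ring
      _ ≤ (n + 1 + 1) * m * m ^ n := Nat.mul_le_mul_right _ (by linarith)
      _ = (n + 1 + 1) * m ^ (n + 1) := by ring

theorem add_one_rpow_le_rpow_mul_rpow (k : ℕ) :
    ((k : ℝ) + 1) ^ ((k : ℝ) / (k + 1)) ≤
      ((k : ℝ) + 1) ^ ((1 : ℝ) / (k + 1)) * (k : ℝ) ^ ((k : ℝ) / (k + 1)) := by
  have hpow : (((k : ℝ) + 1) ^ k) ^ ((1 : ℝ) / (k + 1)) ≤
      (((k : ℝ) + 1) * (k : ℝ) ^ k) ^ ((1 : ℝ) / (k + 1)) :=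
    Real.rpow_le_rpow (by positivity) (mod_cast add_one_pow_le_add_one_mul_pow le_rfl)
      (by positivity)
  rwa [Real.mul_rpow (by positivity) (by positivity), ← Real.rpow_natCast_mul (by positivity),
    ← Real.rpow_natCast_mul (by positivity), mul_one_div] at hpow

theorem pow_card_le_weighted_prod {ι : Type*} [Fintype ι] {v w r : ℝ} {p q : ι → ℝ} (hv : 0 ≤ v)
    (hw : 0 ≤ w) (hvw : v + w = 1) (hr : 0 ≤ r) (hp : ∀ i, 0 ≤ p i) (hq : ∀ i, 0 ≤ q i)
    (h : ∀ i, r ≤ p i ^ v * q i ^ w) :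
    r ^ Fintype.card ι ≤ v * ∏ i, p i + w * ∏ i, q i := by
  calc r ^ Fintype.card ι = ∏ _i : ι, r := by rw [prod_const, card_univ]
    _ ≤ ∏ i, p i ^ v * q i ^ w := prod_le_prod (fun _ _ => hr) fun i _ => h i
    _ = (∏ i, p i) ^ v * (∏ i, q i) ^ w := by
        rw [prod_mul_distrib, Real.finsetProd_rpow _ _ fun i _ => hp i,
          Real.finsetProd_rpow _ _ fun i _ => hq i]
    _ ≤ v * ∏ i, p i + w * ∏ i, q i := Real.geom_mean_le_arith_mean2_weighted hv hw
        (prod_nonneg fun i _ => hp i) (prod_nonneg fun i _ => hq i) hvw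

variable {ι : Type*} [Fintype ι] {A : Finset (ι → ℤ)} {k : ℕ}

theorem IsCompressed.sum_prod_le_card_nsmul (hA : IsCompressed Set.univ A) (k : ℕ) :
    ∑ x ∈ A, ∏ i, (if x i = 0 then 1 else k) ≤ #(k • A) := by
  classical
  refine sum_prod_ite_le_card (c := 0) (fun x => hA.nonneg) fun x hx => ?_
  calc Icc 0 (((0 : ℕ) : ι → ℤ) + k • x) = k • Icc 0 x := by
        rw [nsmul_Icc_of_le (hA.nonneg hx), nsmul_zero, Nat.cast_zero, zero_add]
    _ ⊆ k • A := nsmul_subset_nsmul_left (hA.Icc_zero_subset hx)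

variable [DecidableEq ι]

theorem IsCompressed.sum_prod_le_card_nsmul_succ (hA : IsCompressed Set.univ A)
    (hC : Icc 0 (k : ι → ℤ) ⊆ A) :
    ∑ x ∈ A, ∏ i, (if x i = 0 then k + 1 else k) ≤ #((k + 1) • A) := by
  refine sum_prod_ite_le_card (fun x => hA.nonneg) fun x hx => ?_
  calc Icc 0 ((k : ι → ℤ) + k • x) = Icc 0 (k : ι → ℤ) + k • Icc 0 x := by
        rw [nsmul_Icc_of_le (hA.nonneg hx), nsmul_zero,
          Icc_add_Icc_of_le (Nat.cast_nonneg k) (nsmul_nonneg (hA.nonneg hx) k),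
          zero_add]
    _ ⊆ A + k • A := add_subset_add hC (nsmul_subset_nsmul_left (hA.Icc_zero_subset hx))
    _ = (k + 1) • A := (succ_nsmul' A k).symm

theorem IsCompressed.rpow_mul_card_le_card_nsmul (hA : IsCompressed Set.univ A)
    (hC : Icc 0 (k : ι → ℤ) ⊆ A) :
    (((k : ℝ) + 1) ^ ((k : ℝ) / (k + 1))) ^ Fintype.card ι * #A ≤ #((k + 1) • A) := by
  have hv : 0 ≤ (1 : ℝ) / (k + 1) := by positivity
  have hw : 0 ≤ (k : ℝ) / (k + 1) := by positivity
  have hvw : (1 : ℝ) / (k + 1) + k / (k + 1) = 1 := by field_simp; ring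
  have hp : ∑ x ∈ A, ∏ i, (if x i = 0 then (1 : ℝ) else k + 1) ≤ #((k + 1) • A) :=
    mod_cast hA.sum_prod_le_card_nsmul (k + 1)
  have hq : ∑ x ∈ A, ∏ i, (if x i = 0 then (k : ℝ) + 1 else k) ≤ #((k + 1) • A) :=
    mod_cast hA.sum_prod_le_card_nsmul_succ hC
  calc (((k : ℝ) + 1) ^ ((k : ℝ) / (k + 1))) ^ Fintype.card ι * #A
      = ∑ x ∈ A, (((k : ℝ) + 1) ^ ((k : ℝ) / (k + 1))) ^ Fintype.card ι := by
        rw [sum_const, nsmul_eq_mul, mul_comm]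
    _ ≤ ∑ x ∈ A, ((1 : ℝ) / (k + 1) * ∏ i, (if x i = 0 then (1 : ℝ) else k + 1) +
          k / (k + 1) * ∏ i, (if x i = 0 then (k : ℝ) + 1 else k)) := by
        refine sum_le_sum fun x _ => pow_card_le_weighted_prod hv hw hvw (by positivity)
          (fun i => ?_) (fun i => ?_) fun i => ?_
        · split_ifs <;> positivity
        · split_ifs <;> positivity
        · split_ifs
          · rw [Real.one_rpow, one_mul]
          · exact add_one_rpow_le_rpow_mul_rpow k
    _ = (1 : ℝ) / (k + 1) * ∑ x ∈ A, ∏ i, (if x i = 0 then (1 : ℝ) else k + 1) +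
          k / (k + 1) * ∑ x ∈ A, ∏ i, (if x i = 0 then (k : ℝ) + 1 else k) := by
        rw [sum_add_distrib, mul_sum, mul_sum]
    _ ≤ (1 : ℝ) / (k + 1) * #((k + 1) • A) + k / (k + 1) * #((k + 1) • A) := by gcongr
    _ = #((k + 1) • A) := by rw [← add_mul, hvw, one_mul]

theorem rpow_mul_card_le_card_nsmul (hC : Icc 0 (k : ι → ℤ) ⊆ A) :
    (((k : ℝ) + 1) ^ ((k : ℝ) / (k + 1))) ^ Fintype.card ι * #A ≤ #((k + 1) • A) := by
  obtain ⟨B, hB, hcard, hsum, hbox⟩ := exists_isCompressed_univ A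
  rw [← hcard]
  exact (hB.rpow_mul_card_le_card_nsmul (hbox _ hC)).trans (mod_cast hsum (k + 1))

theorem rpow_le_infGrowth (d : ℕ) {k : ℕ} (hk : 1 ≤ k) :
    (k : ℝ) ^ ((d : ℝ) * ((k : ℝ) - 1) / (k : ℝ)) ≤ infGrowth d k := by
  obtain ⟨m, rfl⟩ := Nat.exists_eq_add_of_le' hk
  refine (isGLB_infGrowth d (m + 1)).2 ?_
  rintro r ⟨A, hA, rfl⟩
  rw [cube_succ] at hA
  have hpos : (0 : ℝ) < #A :=
    mod_cast card_pos.2 ⟨0, hA (mem_Icc.2 ⟨le_rfl, Nat.cast_nonneg m⟩)⟩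
  rw [kSumset_eq_nsmul, le_div_iff₀ hpos]
  refine le_trans (le_of_eq ?_) (rpow_mul_card_le_card_nsmul hA)
  rw [Fintype.card_fin, ← Real.rpow_mul_natCast (by positivity)]
  push_cast
  congr 2
  ring

end LowerBound

section UpperBound

theorem card_cube (d k : ℕ) : #(cube d k) = k ^ d := by
  simp [cube]

theorem card_kSumset_cube_succ (d k : ℕ) :
    #(kSumset (k + 1) (cube d (k + 1))) = ((k + 1) * k + 1) ^ d := by
  rw [kSumset_eq_nsmul, cube_succ, nsmul_Icc_of_le (Nat.cast_nonneg k),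
    Pi.card_Icc, ← Fin.prod_const]
  refine prod_congr rfl fun i _ => ?_
  simp only [Int.card_Icc, Pi.smul_apply, Pi.zero_apply, nsmul_eq_mul, Pi.natCast_apply,
    mul_zero, sub_zero]
  norm_cast

theorem infGrowth_le (d : ℕ) {k : ℕ} (hk : 1 ≤ k) :
    infGrowth d k ≤ ((k : ℝ) - 1 + 1 / (k : ℝ)) ^ d := by
  obtain ⟨m, rfl⟩ := Nat.exists_eq_add_of_le' hk
  refine ((isGLB_infGrowth d (m + 1)).1 ⟨_, Subset.rfl, rfl⟩).trans_eq ?_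
  rw [card_kSumset_cube_succ, card_cube]
  push_cast
  rw [← div_pow]
  congr 1
  field_simp
  ring

end UpperBound

section Limit

theorem tendsto_div_of_le_of_le {α : Type*} {f : Filter α} {l u g : α → ℝ}
    (hl : ∀ᶠ a in f, 0 < l a) (hlg : ∀ᶠ a in f, l a ≤ g a) (hgu : ∀ᶠ a in f, g a ≤ u a)
    (h : Tendsto (fun a => u a / l a) f (𝓝 1)) :
    Tendsto (fun a => g a / l a) f (𝓝 1) ∧ Tendsto (fun a => g a / u a) f (𝓝 1) := by
  have hgl : Tendsto (fun a => g a / l a) f (𝓝 1) := by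
    refine tendsto_of_tendsto_of_tendsto_of_le_of_le' tendsto_const_nhds h ?_ ?_
    · filter_upwards [hl, hlg] with a hla hlga using (one_le_div hla).2 hlga
    · filter_upwards [hl, hgu] with a hla hgua using div_le_div_of_nonneg_right hgua hla.le
  refine ⟨hgl, ?_⟩
  have hdiv : Tendsto (fun a => g a / l a / (u a / l a)) f (𝓝 1) := by
    simpa only [div_one] using! hgl.div h one_ne_zero
  refine hdiv.congr' ?_
  filter_upwards [hl] with a hla using div_div_div_cancel_right₀ hla.ne' _ _

theorem tendsto_pow_div_rpow (d : ℕ) :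
    Tendsto (fun k : ℕ => ((k : ℝ) - 1 + 1 / (k : ℝ)) ^ d /
      (k : ℝ) ^ ((d : ℝ) * ((k : ℝ) - 1) / (k : ℝ))) atTop (𝓝 1) := by
  have hroot : Tendsto (fun k : ℕ => (k : ℝ) ^ ((1 : ℝ) / k)) atTop (𝓝 1) :=
    tendsto_rpow_div.comp tendsto_natCast_atTop_atTop
  have hinv : Tendsto (fun k : ℕ => (1 : ℝ) / k) atTop (𝓝 0) := tendsto_one_div_atTop_nhds_zero_nat
  have hlim : Tendsto (fun k : ℕ => ((1 - (1 : ℝ) / k + (1 : ℝ) / k * ((1 : ℝ) / k)) *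
      (k : ℝ) ^ ((1 : ℝ) / k)) ^ d) atTop (𝓝 1) := by
    simpa using (((hinv.const_sub 1).add (hinv.mul hinv)).mul hroot).pow d
  refine hlim.congr' ?_
  filter_upwards [eventually_gt_atTop 0] with k hk
  have hk0 : (0 : ℝ) < k := mod_cast hk
  have hexp : (d : ℝ) * ((k : ℝ) - 1) / k = (1 - 1 / k) * d := by field_simp
  rw [hexp, Real.rpow_mul_natCast hk0.le, ← div_pow, Real.rpow_sub hk0, Real.rpow_one]
  congr 1
  field_simp

end Limit

end CubeSumset

theorem theorem1p5 (d : ℕ) (hd : 1 ≤ d) :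
    (∀ k : ℕ, 1 ≤ k →
      (k : ℝ) ^ ((d : ℝ) * ((k : ℝ) - 1) / (k : ℝ)) ≤ CubeSumset.infGrowth d k ∧
      CubeSumset.infGrowth d k ≤ ((k : ℝ) - 1 + 1 / (k : ℝ)) ^ d) ∧
    Tendsto (fun k : ℕ => ((k : ℝ) - 1 + 1 / (k : ℝ)) ^ d /
      (k : ℝ) ^ ((d : ℝ) * ((k : ℝ) - 1) / (k : ℝ))) atTop (𝓝 1) ∧
    Tendsto (fun k : ℕ => CubeSumset.infGrowth d k /
      (k : ℝ) ^ ((d : ℝ) * ((k : ℝ) - 1) / (k : ℝ))) atTop (𝓝 1) ∧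
    Tendsto (fun k : ℕ => CubeSumset.infGrowth d k /
      ((k : ℝ) - 1 + 1 / (k : ℝ)) ^ d) atTop (𝓝 1) := by
  have bounds : ∀ k : ℕ, 1 ≤ k →
      (k : ℝ) ^ ((d : ℝ) * ((k : ℝ) - 1) / (k : ℝ)) ≤ CubeSumset.infGrowth d k ∧
      CubeSumset.infGrowth d k ≤ ((k : ℝ) - 1 + 1 / (k : ℝ)) ^ d := fun k hk =>
    ⟨CubeSumset.rpow_le_infGrowth d hk, CubeSumset.infGrowth_le d hk⟩
  have lower_pos : ∀ᶠ k : ℕ in atTop, 0 < (k : ℝ) ^ ((d : ℝ) * ((k : ℝ) - 1) / (k : ℝ)) := by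
    filter_upwards [eventually_gt_atTop 0] with k hk using Real.rpow_pos_of_pos (mod_cast hk) _
  have ratio := CubeSumset.tendsto_pow_div_rpow d
  have bounds_eventually := (eventually_ge_atTop 1).mono bounds
  exact ⟨bounds, ratio, CubeSumset.tendsto_div_of_le_of_le lower_pos
    (bounds_eventually.mono fun _ => And.left) (bounds_eventually.mono fun _ => And.right) ratio⟩
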